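/- Let $X$ and $Y$ be locally compact Hausdorff spaces, and let $E$ and $F$ be real or complex normed spaces, not necessarily complete, with $F\neq\{0\}$. Let $C_0(X,E)$ be the space of continuous functions $X\to E$ vanishing at infinity, with the supremum norm, and similarly $C_0(Y,F)$. For a normed space $G$ let $S(G)$ be its unit sphere and, for $e\in G$, put $\mathrm{St}(e)=\{e'\in S(G):\|e+e'\|=2\}$; let $\mathrm{ext}(G_1^*)$ be the set of extreme points of the closed unit ball of the dual space $G^*$. A T-set in $G$ is a subset of $G$ that is maximal with respect to the property that $\|e_1+\dots+e_n\|=\|e_1\|+\dots+\|e_n\|$ for all $n\in\mathbb N$ and all $e_1,\dots,e_n$ in it. Consider the following conditions on $G$: (i) $S(G)$ contains an element $v_0$ with $\mathrm{St}(v_0)=\{v_0\}$; (ii) $\mathrm{ext}(G_1^*)$ contains an element $w_0^*$ with $\mathrm{St}(w_0^*)=\{w_0^*\}$, where $\mathrm{St}(w_0^*)$ is formed in $G^*$; (iii) $G$ has property (D): for any two distinct T-sets $S_1,S_2$ in $G$, either $S_1\cap S_2=\{0\}$ or there is a T-set $L$ in $G$ with $S_1\cap L=\{0\}=S_2\cap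 L$. Let $T:C_0(X,E)\to C_0(Y,F)$ be a surjective real-linear isometry, and assume that $F$ satisfies at least one of (i), (ii), (iii). Then there exist a continuous map $\Phi:Y\to X$ and a family $\{V_y\}_{y\in Y}$ of bounded real-linear operators from $E$ to $F$ with $\|V_y\|\le 1$ such that \[ Tf(y)=V_y(f(\Phi(y)))\qquad (f\in C_0(X,E),\ y\in Y). \] Moreover, if $E\neq\{0\}$ and $E$ satisfies the same condition as $F$ (that is, at least one of (i), (ii), (iii) holds for both $E$ and $F$), then $\Phi$ is a homeomorphism and each $V_y$ is a surjective isometry of $E$ onto $F$. -/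

import Mathlib

open scoped ZeroAtInfty

/-- The star-like set `St(e) = {e' ∈ S(E) : ‖e + e'‖ = 2}`, where `S(E)` is the unit sphere. -/
def starSet {E : Type*} [NormedAddCommGroup E] (e : E) : Set E :=
  {e' | e' ∈ Metric.sphere (0 : E) 1 ∧ ‖e + e'‖ = 2}

/-- The norm is additive on all finite families (repetitions allowed) of elements of `S`. -/
def NormAdditiveOn {E : Type*} [NormedAddCommGroup E] (S : Set E) : Prop :=
  ∀ (n : ℕ) (e : Fin n → E), (∀ i, e i ∈ S) → ‖∑ i, e i‖ = ∑ i, ‖e i‖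

/-- A T-set: a subset maximal (for inclusion) among those on which the norm is additive. -/
def IsTSet {E : Type*} [NormedAddCommGroup E] (S : Set E) : Prop :=
  Maximal NormAdditiveOn S

/-- Property (D). -/
def PropertyD (E : Type*) [NormedAddCommGroup E] : Prop :=
  ∀ S₁ S₂ : Set E, IsTSet S₁ → IsTSet S₂ → S₁ ≠ S₂ →
    S₁ ∩ S₂ = {0} ∨ ∃ L : Set E, IsTSet L ∧ S₁ ∩ L = {0} ∧ S₂ ∩ L = {0}

/-- Some unit vector `v₀` satisfies `St(v₀) = {v₀}`. -/
def HasStarPoint (E : Type*) [NormedAddCommGroup E] : Prop :=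
  ∃ v₀ ∈ Metric.sphere (0 : E) 1, starSet v₀ = {v₀}

/-- Some extreme point `w₀` of the closed unit ball of the dual `E*` (the space of bounded
`𝕜`-linear functionals) satisfies `St(w₀) = {w₀}`. -/
def HasDualStarPoint (𝕜 E : Type*) [RCLike 𝕜] [NormedAddCommGroup E] [NormedSpace 𝕜 E] : Prop :=
  letI : NormedSpace ℝ (StrongDual 𝕜 E) := NormedSpace.restrictScalars ℝ 𝕜 (StrongDual 𝕜 E)
  ∃ w₀ ∈ Set.extremePoints ℝ (Metric.closedBall (0 : StrongDual 𝕜 E) 1), starSet w₀ = {w₀}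

/-!
For an extreme point `w` of the dual unit ball of `F` and `y : Y`, the functional `g ↦ w (g y)` is
an extreme point of the dual unit ball of `C₀(Y, F)`, so its composition with the isometry `T` is
one for `C₀(X, E)`. Multiplying by a scalar function `u` with values in `[0, 1]` splits such a
functional `ψ` into two parts whose norms add up to `1`, so `f ↦ ψ (u • f)` is a multiple of `ψ`;
this forces `ψ f` to depend only on the value of `f` at one point `x`.

If `w₁` and `w₂` lead in this way to distinct points of `X`, then cutting and pasting functions on
`X` shows that the values of `w₁` and `w₂` can be prescribed independently on the unit ball of `F`.
Each of the conditions (i), (ii), (iii) forbids this for enough pairs of functionals: chains of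
non-independent extreme functionals starting at a single one separate the points of `F` from `0`.
All of these functionals lead to the same point `Φ y`, so `T f y` depends only on `f (Φ y)`.
If this applies to the inverse of `T` as well, the symbols and weights of the two operators are
inverse to each other, and contractions with contractive inverses are isometries.
-/

open Set Filter Topology Metric

theorem norm_eq_one_of_starSet_eq {E : Type*} [NormedAddCommGroup E] {e : E}
    (he : starSet e = {e}) : ‖e‖ = 1 :=
  mem_sphere_zero_iff_norm.1 (he.symm ▸ mem_singleton e : e ∈ starSet e).1

section DualBall

variable {F G : Type*} [NormedAddCommGroup F] [NormedSpace ℝ F] [NormedAddCommGroup G]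
  [NormedSpace ℝ G]

theorem apply_le_norm_of_norm_le_one {w : StrongDual ℝ F} (hw : ‖w‖ ≤ 1) (z : F) : w z ≤ ‖z‖ :=
  (le_abs_self _).trans ((w.le_of_opNorm_le hw z).trans_eq (one_mul _))

theorem norm_le_of_forall_apply_le {w : StrongDual ℝ F} {r : ℝ} (h : ∀ z, ‖z‖ ≤ 1 → w z ≤ r) :
    ‖w‖ ≤ r := by
  refine w.opNorm_le_of_unit_norm (by simpa using h 0 (by simp)) fun z hz =>
    abs_le.2 ⟨neg_le.1 ?_, h z hz.le⟩
  simpa using h (-z) (by simp [hz])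

theorem norm_add_norm_le_of_forall_apply_add_le {w : StrongDual ℝ F} {v : StrongDual ℝ G} {r : ℝ}
    (h : ∀ z e, ‖z‖ ≤ 1 → ‖e‖ ≤ 1 → w z + v e ≤ r) : ‖w‖ + ‖v‖ ≤ r :=
  le_sub_iff_add_le.1 <| norm_le_of_forall_apply_le fun z hz => le_sub_comm.1 <|
    norm_le_of_forall_apply_le fun e he => le_sub_iff_add_le'.2 (h z e hz he)

/-- The set `ext(F_1^*)` of extreme points of the closed unit ball of the real dual of `F`. -/
abbrev dualExtremePoints (F : Type*) [NormedAddCommGroup F] [NormedSpace ℝ F] :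
    Set (StrongDual ℝ F) :=
  extremePoints ℝ (closedBall 0 1)

theorem norm_le_one_of_mem_dualExtremePoints {w : StrongDual ℝ F} (hw : w ∈ dualExtremePoints F) :
    ‖w‖ ≤ 1 :=
  mem_closedBall_zero_iff.1 hw.1

theorem norm_eq_one_of_mem_dualExtremePoints [Nontrivial F] {w : StrongDual ℝ F}
    (hw : w ∈ dualExtremePoints F) : ‖w‖ = 1 :=
  mem_sphere_zero_iff_norm.1 (extremePoints_closedBall_subset_sphere hw)

theorem comp_mem_dualExtremePoints (T : F ≃ₗᵢ[ℝ] G) {w : StrongDual ℝ G}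
    (hw : w ∈ dualExtremePoints G) : w ∘L (T : F →L[ℝ] G) ∈ dualExtremePoints F := by
  let D : StrongDual ℝ G ≃ₗᵢ[ℝ] StrongDual ℝ F :=
    ⟨(T.symm.toContinuousLinearEquiv.arrowCongr (.refl ℝ ℝ)).toLinearEquiv,
      fun w => w.opNorm_comp_linearIsometryEquiv T⟩
  have hD := image_extremePoints (𝕜 := ℝ) D (closedBall 0 1)
  rw [D.image_closedBall, map_zero] at hD
  exact hD.subset (mem_image_of_mem D hw)

theorem eq_norm_smul_of_mem_extremePoints_closedBall {w a : F} (hw1 : ‖w‖ = 1)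
    (hw : w ∈ extremePoints ℝ (closedBall (0 : F) 1)) (h : ‖a‖ + ‖w - a‖ ≤ 1) :
    a = ‖a‖ • w := by
  rcases (norm_nonneg a).eq_or_lt with ha | ha
  · rw [← ha, zero_smul, norm_eq_zero.1 ha.symm]
  rcases (norm_nonneg (w - a)).eq_or_lt with hb | hb
  · rw [← sub_eq_zero.1 (norm_eq_zero.1 hb.symm), hw1, one_smul]
  have normalized_eq : ‖a‖⁻¹ • a = w := by
    refine hw.2 (x₂ := (1 - ‖a‖)⁻¹ • (w - a)) ?_ ?_ ⟨‖a‖, 1 - ‖a‖, ha, by linarith, by ring, ?_⟩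
    · rw [mem_closedBall_zero_iff, norm_smul, norm_inv, norm_norm, inv_mul_cancel₀ ha.ne']
    · rw [mem_closedBall_zero_iff, norm_smul, norm_inv, Real.norm_of_nonneg (by linarith),
        inv_mul_le_one₀ (by linarith)]
      linarith
    · rw [smul_inv_smul₀ ha.ne', smul_inv_smul₀ (by linarith), add_sub_cancel]
  rw [← normalized_eq, smul_inv_smul₀ ha.ne']

theorem mem_extremePoints_closedBall_iff {w : F} (hw : ‖w‖ = 1) :
    w ∈ extremePoints ℝ (closedBall (0 : F) 1) ↔ ∀ a, ‖a‖ + ‖w - a‖ ≤ 1 → a = ‖a‖ • w := by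
  refine ⟨fun h a => eq_norm_smul_of_mem_extremePoints_closedBall hw h,
    fun h => ⟨by simp [hw], fun a ha b hb ⟨s, t, hs, ht, hst, hab⟩ => ?_⟩⟩
  rw [mem_closedBall_zero_iff] at ha hb
  have hsa : ‖s • a‖ = s * ‖a‖ := by rw [norm_smul, Real.norm_of_nonneg hs.le]
  have htb : ‖t • b‖ = t * ‖b‖ := by rw [norm_smul, Real.norm_of_nonneg ht.le]
  have hsa' : s * ‖a‖ ≤ s := mul_le_of_le_one_right hs.le ha
  have htb' : t * ‖b‖ ≤ t := mul_le_of_le_one_right ht.le hb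
  have hle : 1 ≤ s * ‖a‖ + t * ‖b‖ := by
    rw [← hw, ← hab, ← hsa, ← htb]
    exact norm_add_le _ _
  have hsmul : s • a = (s * ‖a‖) • w := hsa ▸ h (s • a) (by
    rw [← hab, add_sub_cancel_left, hsa, htb]
    linarith)
  rw [show s * ‖a‖ = s by linarith] at hsmul
  exact smul_right_injective F hs.ne' hsmul

theorem mem_extremePoints_closedBall_of_starSet_eq {w : F} (hw : starSet w = {w}) :
    w ∈ extremePoints ℝ (closedBall (0 : F) 1) := by
  have hw1 := norm_eq_one_of_starSet_eq hw
  refine (mem_extremePoints_closedBall_iff hw1).2 fun a ha => ?_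
  rcases eq_or_ne a 0 with rfl | ha0
  · simp
  have hpos := norm_pos_iff.2 ha0
  have hnorm : ‖‖a‖⁻¹ • a‖ = 1 := norm_smul_inv_norm (𝕜 := ℝ) ha0
  have hstar : 2 ≤ ‖w + ‖a‖⁻¹ • a‖ := by
    refine le_of_mul_le_mul_left ?_ hpos
    have hdecomp : (1 + ‖a‖) • w = ‖a‖ • (w + ‖a‖⁻¹ • a) + (w - a) := by
      rw [smul_add, smul_inv_smul₀ hpos.ne']
      module
    have := (hdecomp ▸ norm_add_le (‖a‖ • (w + ‖a‖⁻¹ • a)) (w - a) :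
      ‖(1 + ‖a‖) • w‖ ≤ _)
    rw [norm_smul, norm_smul, hw1, norm_norm, Real.norm_of_nonneg (by positivity)] at this
    linarith
  have hmem : ‖a‖⁻¹ • a ∈ starSet w :=
    ⟨mem_sphere_zero_iff_norm.2 hnorm,
      ((norm_add_le _ _).trans_eq (by rw [hw1, hnorm]; norm_num)).antisymm hstar⟩
  rw [hw, mem_singleton_iff] at hmem
  rw [← hmem, smul_inv_smul₀ hpos.ne']

end DualBall

section NormAdditive

variable {F : Type*} [NormedAddCommGroup F]

theorem NormAdditiveOn.norm_sum {S : Set F} (hS : NormAdditiveOn S) {ι : Type*} (t : Finset ι)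
    {e : ι → F} (he : ∀ i ∈ t, e i ∈ S) : ‖∑ i ∈ t, e i‖ = ∑ i ∈ t, ‖e i‖ := by
  have h := hS t.card (fun i => e (t.equivFin.symm i)) fun i => he _ (t.equivFin.symm i).2
  rw [t.equivFin.symm.sum_comp fun i : t => e i,
    t.equivFin.symm.sum_comp fun i : t => ‖e i‖] at h
  rwa [← Finset.sum_coe_sort t, ← Finset.sum_coe_sort t]

theorem NormAdditiveOn.sUnion {c : Set (Set F)} (hc : ∀ S ∈ c, NormAdditiveOn S)
    (hchain : IsChain (· ⊆ ·) c) (hne : c.Nonempty) : NormAdditiveOn (⋃₀ c) := by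
  intro n e he
  obtain ⟨S, hS, heS⟩ := hchain.directedOn.exists_mem_subset_of_finset_subset_biUnion hne
    (f := id) (s := (finite_range e).toFinset) (by
      simpa [range_subset_iff] using he)
  exact hc S hS n e fun i => heS (by simp)

theorem NormAdditiveOn.exists_isTSet {R : Set F} (hR : NormAdditiveOn R) :
    ∃ S, IsTSet S ∧ R ⊆ S := by
  obtain ⟨S, hRS, hS⟩ := zorn_subset_nonempty {S : Set F | NormAdditiveOn S}
    (fun c hc hchain hne => ⟨⋃₀ c, .sUnion hc hchain hne, fun _ => subset_sUnion_of_mem⟩) R hR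
  exact ⟨S, hS, hRS⟩

variable [NormedSpace ℝ F]

theorem apply_eq_norm_of_apply_sum_eq {w : StrongDual ℝ F} (hw : ‖w‖ ≤ 1) {ι : Type*}
    {t : Finset ι} {e : ι → F} (h : w (∑ i ∈ t, e i) = ∑ i ∈ t, ‖e i‖) {i : ι} (hi : i ∈ t) :
    w (e i) = ‖e i‖ := by
  rw [map_sum] at h
  exact (Finset.sum_eq_sum_iff_of_le fun j _ => apply_le_norm_of_norm_le_one hw (e j)).1 h i hi

theorem normAdditiveOn_setOf_apply_eq_norm {w : StrongDual ℝ F} (hw : ‖w‖ ≤ 1) :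
    NormAdditiveOn {z | w z = ‖z‖} := by
  intro n e he
  refine (norm_sum_le _ _).antisymm ?_
  calc ∑ i, ‖e i‖ = w (∑ i, e i) := by
        rw [map_sum]; exact Finset.sum_congr rfl fun i _ => (he i).symm
    _ ≤ ‖∑ i, e i‖ := apply_le_norm_of_norm_le_one hw _

/-- The functionals in the dual unit ball that attain their norm bound at every point of `S`, as a
subset of the weak dual so that it is compact. -/
def normingFunctionals (S : Set F) : Set (WeakDual ℝ F) :=
  WeakDual.toStrongDual ⁻¹' closedBall 0 1 ∩ ⋂ s : S, {w | w (s : F) = ‖(s : F)‖}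

theorem isClosed_setOf_apply_eq_norm (z : F) : IsClosed {w : WeakDual ℝ F | w z = ‖z‖} :=
  isClosed_eq (WeakDual.eval_continuous z) continuous_const

theorem isCompact_normingFunctionals (S : Set F) : IsCompact (normingFunctionals S) :=
  (WeakDual.isCompact_closedBall 0 1).inter_right
    (isClosed_iInter fun s : S => isClosed_setOf_apply_eq_norm (s : F))

theorem NormAdditiveOn.nonempty_normingFunctionals {S : Set F} (hS : NormAdditiveOn S) :
    (normingFunctionals S).Nonempty := by
  refine (WeakDual.isCompact_closedBall 0 1).inter_iInter_nonempty _
    (fun s : S => isClosed_setOf_apply_eq_norm (s : F)) fun t => ?_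
  obtain ⟨g, hg, hgt⟩ := exists_dual_vector'' ℝ (∑ s ∈ t, (s : F))
  have hsum : g (∑ s ∈ t, (s : F)) = ∑ s ∈ t, ‖(s : F)‖ :=
    hgt.trans (hS.norm_sum t fun s _ => s.2)
  exact ⟨StrongDual.toWeakDual g, mem_closedBall_zero_iff.2 hg,
    mem_iInter₂.2 fun s hs => apply_eq_norm_of_apply_sum_eq hg hsum hs⟩

theorem isExtreme_normingFunctionals (S : Set F) :
    IsExtreme ℝ (WeakDual.toStrongDual ⁻¹' closedBall 0 1) (normingFunctionals S) := by
  refine ⟨inter_subset_left, fun a ha b hb w hw ⟨p, q, hp, hq, hpq, hab⟩ =>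
    ⟨ha, mem_iInter.2 fun s => ?_⟩⟩
  have has := apply_le_norm_of_norm_le_one (mem_closedBall_zero_iff.1 ha) (s : F)
  have hbs := apply_le_norm_of_norm_le_one (mem_closedBall_zero_iff.1 hb) (s : F)
  have hws : p * a (s : F) + q * b (s : F) = ‖(s : F)‖ := by
    rw [← mem_iInter.1 hw.2 s, ← hab]; rfl
  refine has.antisymm (le_of_mul_le_mul_left ?_ hp)
  calc p * ‖(s : F)‖ = ‖(s : F)‖ - q * ‖(s : F)‖ := by rw [eq_sub_of_add_eq hpq]; ring
    _ ≤ ‖(s : F)‖ - q * b (s : F) := by gcongr; exact hbs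
    _ = p * a (s : F) := by rw [← hws, add_sub_cancel_right]

theorem NormAdditiveOn.exists_mem_dualExtremePoints {S : Set F} (hS : NormAdditiveOn S) :
    ∃ w ∈ dualExtremePoints F, ∀ s ∈ S, w s = ‖s‖ := by
  have : LocallyConvexSpace ℝ (WeakDual ℝ F) :=
    inferInstanceAs (LocallyConvexSpace ℝ (WeakBilin (topDualPairing ℝ F)))
  obtain ⟨w, hw⟩ :=
    (isCompact_normingFunctionals S).extremePoints_nonempty hS.nonempty_normingFunctionals
  exact ⟨WeakDual.toStrongDual w,
    (isExtreme_normingFunctionals S).extremePoints_subset_extremePoints hw,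
    fun s hs => mem_iInter.1 hw.1.2 ⟨s, hs⟩⟩

theorem exists_mem_dualExtremePoints_apply_eq_norm (z : F) :
    ∃ w ∈ dualExtremePoints F, w z = ‖z‖ := by
  obtain ⟨g, hg, hgz⟩ := exists_dual_vector'' ℝ z
  obtain ⟨w, hw, h⟩ := (normAdditiveOn_setOf_apply_eq_norm hg).exists_mem_dualExtremePoints
  exact ⟨w, hw, h z hgz⟩

theorem IsTSet.eq_setOf_apply_eq_norm {S : Set F} (hS : IsTSet S) {w : StrongDual ℝ F}
    (hw : ‖w‖ ≤ 1) (h : ∀ s ∈ S, w s = ‖s‖) : S = {z | w z = ‖z‖} :=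
  hS.eq_of_subset (normAdditiveOn_setOf_apply_eq_norm hw) h

theorem exists_isTSet_mem (z : F) : ∃ S, IsTSet S ∧ z ∈ S := by
  obtain ⟨g, hg, hgz⟩ := exists_dual_vector'' ℝ z
  obtain ⟨S, hS, h⟩ := (normAdditiveOn_setOf_apply_eq_norm hg).exists_isTSet
  exact ⟨S, hS, h hgz⟩

theorem IsTSet.exists_ne_zero [Nontrivial F] {S : Set F} (hS : IsTSet S) : ∃ s ∈ S, s ≠ 0 := by
  by_contra! hzero
  obtain ⟨z, hz⟩ := exists_ne (0 : F)
  obtain ⟨g, hg, hgz⟩ := exists_dual_vector'' ℝ z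
  have hSg := hS.eq_setOf_apply_eq_norm hg fun s hs => by simp [hzero s hs]
  exact hz (hzero z (hSg ▸ hgz))

theorem IsTSet.exists_norm_eq_one [Nontrivial F] {S : Set F} (hS : IsTSet S) :
    ∃ s ∈ S, ‖s‖ = 1 := by
  obtain ⟨s, hs, hs0⟩ := hS.exists_ne_zero
  obtain ⟨w, hw, hwS⟩ := hS.prop.exists_mem_dualExtremePoints
  refine ⟨‖s‖⁻¹ • s, ?_, norm_smul_inv_norm (𝕜 := ℝ) hs0⟩
  rw [hS.eq_setOf_apply_eq_norm (norm_le_one_of_mem_dualExtremePoints hw) hwS]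
  simp [norm_smul, hwS s hs]

end NormAdditive

section LinkedDual

variable {F : Type*} [NormedAddCommGroup F] [NormedSpace ℝ F]

/-- Two functionals can be prescribed independently on the closed unit ball: every pair of values
attained separately is attained simultaneously. Functionals that an isometry of `C₀` spaces
carries to distinct points have this property. -/
def BallIndependent (w₁ w₂ : StrongDual ℝ F) : Prop :=
  ∀ z₁ z₂, ‖z₁‖ ≤ 1 → ‖z₂‖ ≤ 1 → ∃ z, ‖z‖ ≤ 1 ∧ w₁ z = w₁ z₁ ∧ w₂ z = w₂ z₂

/-- The functional `v` is extreme and not independent of `w`. Under an isometry of `C₀` spaces such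
a `v` must be carried to the same point as `w`. -/
def Linked (w v : StrongDual ℝ F) : Prop :=
  v ∈ dualExtremePoints F ∧ ¬ BallIndependent w v

/-- The common consequence of the conditions `HasStarPoint`, `HasDualStarPoint` and `PropertyD`
through which they enter the theorem: the extreme functionals reachable from a single one along
`Linked` separate the points of `F` from `0`. -/
def HasLinkedDual (F : Type*) [NormedAddCommGroup F] [NormedSpace ℝ F] : Prop :=
  ∃ w₀ ∈ dualExtremePoints F, ∀ z ≠ 0, ∃ w, Relation.ReflTransGen Linked w₀ w ∧ w z ≠ 0

theorem BallIndependent.norm_add {w₁ w₂ : StrongDual ℝ F} (h : BallIndependent w₁ w₂) :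
    ‖w₁ + w₂‖ = ‖w₁‖ + ‖w₂‖ := by
  refine (norm_add_le _ _).antisymm
    (norm_add_norm_le_of_forall_apply_add_le fun z₁ z₂ hz₁ hz₂ => ?_)
  obtain ⟨z, hz, h₁, h₂⟩ := h z₁ z₂ hz₁ hz₂
  rw [← h₁, ← h₂, ← add_apply]
  exact (le_abs_self _).trans ((w₁ + w₂).unit_le_opNorm z hz)

theorem eq_of_starSet_eq_of_apply_eq_one {v₀ z : F} (hstar : starSet v₀ = {v₀})
    {w : StrongDual ℝ F} (hw : ‖w‖ ≤ 1) (hv₀ : w v₀ = 1) (hz : ‖z‖ ≤ 1) (hwz : w z = 1) :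
    z = v₀ := by
  have hz1 : ‖z‖ = 1 := hz.antisymm (hwz ▸ apply_le_norm_of_norm_le_one hw z)
  have hadd : w (v₀ + z) = 2 := by rw [map_add, hv₀, hwz]; norm_num
  have hmem : z ∈ starSet v₀ := ⟨mem_sphere_zero_iff_norm.2 hz1,
    ((norm_add_le _ _).trans_eq (by rw [norm_eq_one_of_starSet_eq hstar, hz1]; norm_num)).antisymm
      (hadd ▸ apply_le_norm_of_norm_le_one hw _)⟩
  rwa [hstar, mem_singleton_iff] at hmem

theorem BallIndependent.eq_zero_of_starSet_eq {v₀ : F} (hstar : starSet v₀ = {v₀})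
    {w₀ w : StrongDual ℝ F} (hw₀ : ‖w₀‖ ≤ 1) (hv₀ : w₀ v₀ = 1) (h : BallIndependent w₀ w) :
    w = 0 := by
  have apply_eq : ∀ z, ‖z‖ ≤ 1 → w v₀ = w z := fun z hz => by
    obtain ⟨z', hz', h₀, h₁⟩ := h v₀ z (norm_eq_one_of_starSet_eq hstar).le hz
    rw [← eq_of_starSet_eq_of_apply_eq_one hstar hw₀ hv₀ hz' (h₀.trans hv₀), h₁]
  have hwv₀ : w v₀ = 0 := by simpa using apply_eq 0 (by simp)
  exact norm_le_zero_iff.1 (norm_le_of_forall_apply_le fun z hz => (apply_eq z hz ▸ hwv₀).le)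

theorem HasStarPoint.hasLinkedDual (h : HasStarPoint F) : HasLinkedDual F := by
  obtain ⟨v₀, hv₀, hstar⟩ := h
  obtain ⟨w₀, hw₀, hwv₀⟩ := exists_mem_dualExtremePoints_apply_eq_norm v₀
  rw [mem_sphere_zero_iff_norm.1 hv₀] at hwv₀
  refine ⟨w₀, hw₀, fun z hz => ?_⟩
  obtain ⟨w, hw, hwz⟩ := exists_mem_dualExtremePoints_apply_eq_norm z
  have hwz0 : w z ≠ 0 := hwz ▸ norm_ne_zero_iff.2 hz
  refine ⟨w, .single ⟨hw, fun hindep => hwz0 ?_⟩, hwz0⟩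
  rw [hindep.eq_zero_of_starSet_eq hstar (norm_le_one_of_mem_dualExtremePoints hw₀) hwv₀,
    zero_apply]

theorem starSet_linearIsometryEquiv {G : Type*} [NormedAddCommGroup G] [NormedSpace ℝ G]
    (e : F ≃ₗᵢ[ℝ] G) (w : F) : starSet (e w) = e '' starSet w := by
  ext a
  obtain ⟨b, rfl⟩ := e.surjective a
  simp only [starSet, mem_ofPred_eq, mem_sphere_zero_iff_norm, ← map_add, e.norm_map,
    e.injective.mem_set_image]

theorem HasDualStarPoint.exists_starSet_eq {𝕜 : Type*} [RCLike 𝕜] [NormedSpace 𝕜 F]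
    [IsScalarTower ℝ 𝕜 F] (h : HasDualStarPoint 𝕜 F) :
    ∃ w : StrongDual ℝ F, starSet w = {w} := by
  obtain ⟨w₀, -, hw₀⟩ := h
  let e := (StrongDual.extendRCLikeₗᵢ (𝕜 := 𝕜) (F := F)).symm
  exact ⟨e w₀, by rw [starSet_linearIsometryEquiv, hw₀, image_singleton]⟩

theorem HasDualStarPoint.hasLinkedDual {𝕜 : Type*} [RCLike 𝕜] [NormedSpace 𝕜 F]
    [IsScalarTower ℝ 𝕜 F] [Nontrivial F] (h : HasDualStarPoint 𝕜 F) : HasLinkedDual F := by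
  obtain ⟨w₀, hstar⟩ := h.exists_starSet_eq
  have hw₀ := mem_extremePoints_closedBall_of_starSet_eq hstar
  refine ⟨w₀, hw₀, fun z hz => ?_⟩
  obtain ⟨w, hw, hwz⟩ := exists_mem_dualExtremePoints_apply_eq_norm z
  have hwz0 : w z ≠ 0 := hwz ▸ norm_ne_zero_iff.2 hz
  rcases eq_or_ne w w₀ with rfl | hne
  · exact ⟨w, .refl, hwz0⟩
  refine ⟨w, .single ⟨hw, fun hindep => hne ?_⟩, hwz0⟩
  have hw1 := norm_eq_one_of_mem_dualExtremePoints hw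
  have hmem : w ∈ starSet w₀ := ⟨mem_sphere_zero_iff_norm.2 hw1, by
    rw [hindep.norm_add, norm_eq_one_of_mem_dualExtremePoints hw₀, hw1]; norm_num⟩
  rwa [hstar, mem_singleton_iff] at hmem

theorem IsTSet.not_ballIndependent [Nontrivial F] {S₁ S₂ : Set F} (hS₁ : IsTSet S₁)
    (hS₂ : IsTSet S₂) (hinter : S₁ ∩ S₂ = {0}) {w₁ w₂ : StrongDual ℝ F} (hw₁ : ‖w₁‖ ≤ 1)
    (hw₂ : ‖w₂‖ ≤ 1) (h₁ : ∀ s ∈ S₁, w₁ s = ‖s‖) (h₂ : ∀ s ∈ S₂, w₂ s = ‖s‖) :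
    ¬ BallIndependent w₁ w₂ := by
  intro hindep
  obtain ⟨s₁, hs₁, hn₁⟩ := hS₁.exists_norm_eq_one
  obtain ⟨s₂, hs₂, hn₂⟩ := hS₂.exists_norm_eq_one
  obtain ⟨z, hz, hz₁, hz₂⟩ := hindep s₁ s₂ hn₁.le hn₂.le
  rw [h₁ s₁ hs₁, hn₁] at hz₁
  rw [h₂ s₂ hs₂, hn₂] at hz₂
  have hz1 : ‖z‖ = 1 := hz.antisymm (hz₁ ▸ apply_le_norm_of_norm_le_one hw₁ z)
  have hmem : z ∈ S₁ ∩ S₂ := by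
    rw [hS₁.eq_setOf_apply_eq_norm hw₁ h₁, hS₂.eq_setOf_apply_eq_norm hw₂ h₂]
    exact ⟨hz₁.trans hz1.symm, hz₂.trans hz1.symm⟩
  rw [hinter, mem_singleton_iff] at hmem
  simp [hmem] at hz1

theorem PropertyD.hasLinkedDual [Nontrivial F] (hD : PropertyD F) : HasLinkedDual F := by
  have linked : ∀ {S₁ S₂ : Set F} {w₁ w₂ : StrongDual ℝ F}, IsTSet S₁ → IsTSet S₂ →
      S₁ ∩ S₂ = {0} → w₁ ∈ dualExtremePoints F → w₂ ∈ dualExtremePoints F →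
      (∀ s ∈ S₁, w₁ s = ‖s‖) → (∀ s ∈ S₂, w₂ s = ‖s‖) → Linked w₁ w₂ :=
    fun hS₁ hS₂ hinter hw₁ hw₂ h₁ h₂ => ⟨hw₂, hS₁.not_ballIndependent hS₂ hinter
      (norm_le_one_of_mem_dualExtremePoints hw₁) (norm_le_one_of_mem_dualExtremePoints hw₂) h₁ h₂⟩
  obtain ⟨S₀, hS₀, -⟩ := exists_isTSet_mem (0 : F)
  obtain ⟨w₀, hw₀, hwS₀⟩ := hS₀.prop.exists_mem_dualExtremePoints
  refine ⟨w₀, hw₀, fun z hz => ?_⟩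
  obtain ⟨S, hS, hzS⟩ := exists_isTSet_mem z
  rcases eq_or_ne S₀ S with rfl | hne
  · exact ⟨w₀, .refl, hwS₀ z hzS ▸ norm_ne_zero_iff.2 hz⟩
  obtain ⟨w, hw, hwS⟩ := hS.prop.exists_mem_dualExtremePoints
  refine ⟨w, ?_, hwS z hzS ▸ norm_ne_zero_iff.2 hz⟩
  rcases hD S₀ S hS₀ hS hne with hinter | ⟨L, hL, hS₀L, hSL⟩
  · exact .single (linked hS₀ hS hinter hw₀ hw hwS₀ hwS)
  · obtain ⟨v, hv, hvL⟩ := hL.prop.exists_mem_dualExtremePoints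
    exact .tail (.single (linked hS₀ hL hS₀L hw₀ hv hwS₀ hvL))
      (linked hL hS (inter_comm S L ▸ hSL) hv hw hvL hwS)

theorem hasLinkedDual_of_conditions {𝕜 : Type*} [RCLike 𝕜] [NormedSpace 𝕜 F]
    [IsScalarTower ℝ 𝕜 F] [Nontrivial F]
    (h : HasStarPoint F ∨ HasDualStarPoint 𝕜 F ∨ PropertyD F) : HasLinkedDual F :=
  h.elim (·.hasLinkedDual) (·.elim (·.hasLinkedDual) (·.hasLinkedDual))

end LinkedDual

section VanishingAtInfinity

variable {X E : Type*} [TopologicalSpace X] [NormedAddCommGroup E]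

theorem norm_apply_le_norm (f : C₀(X, E)) (x : X) : ‖f x‖ ≤ ‖f‖ :=
  f.toBCF.norm_coe_le_norm x

theorem norm_le_of_forall_norm_apply_le {f : C₀(X, E)} {r : ℝ} (hr : 0 ≤ r)
    (h : ∀ x, ‖f x‖ ≤ r) : ‖f‖ ≤ r :=
  (BoundedContinuousFunction.norm_le hr (f := f.toBCF)).2 h

variable [NormedSpace ℝ E]

variable (E) in
/-- Evaluation at a point, as a bounded linear operator on `C₀(X, E)`. -/
noncomputable def evalCLM (x : X) : C₀(X, E) →L[ℝ] E :=
  LinearMap.mkContinuous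
    { toFun f := f x
      map_add' _ _ := rfl
      map_smul' _ _ := rfl } 1 fun f => by simpa using norm_apply_le_norm f x

@[simp]
theorem evalCLM_apply (x : X) (f : C₀(X, E)) : evalCLM E x f = f x := rfl

theorem norm_evalCLM_le_one (x : X) : ‖evalCLM E x‖ ≤ 1 :=
  LinearMap.mkContinuous_norm_le _ zero_le_one _

variable (E) in
/-- Multiplication of vector-valued functions by a fixed scalar function, as a bounded linear
operator on `C₀(X, E)`. -/
noncomputable def mulScalar (u : C₀(X, ℝ)) : C₀(X, E) →L[ℝ] C₀(X, E) :=
  LinearMap.mkContinuous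
    { toFun f := ⟨⟨fun x => u x • f x, by fun_prop⟩, by
        simpa using (zero_at_infty u).smul (zero_at_infty f)⟩
      map_add' _ _ := DFunLike.ext _ _ fun _ => smul_add _ _ _
      map_smul' _ _ := DFunLike.ext _ _ fun _ => smul_comm _ _ _ } ‖u‖ fun f =>
        norm_le_of_forall_norm_apply_le (by positivity) fun x =>
          (norm_smul_le (u x) (f x)).trans (by gcongr <;> apply norm_apply_le_norm)

@[simp]
theorem mulScalar_apply (u : C₀(X, ℝ)) (f : C₀(X, E)) (x : X) :
    mulScalar E u f x = u x • f x := rfl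

@[simp]
theorem mulScalar_zero : mulScalar E (0 : C₀(X, ℝ)) = 0 := by
  ext f x
  simp

theorem mulScalar_mulScalar_of_forall_eq_one {u v : C₀(X, ℝ)} (h : ∀ x, v x ≠ 0 → u x = 1)
    (f : C₀(X, E)) : mulScalar E u (mulScalar E v f) = mulScalar E v f := by
  ext x
  rcases eq_or_ne (v x) 0 with hx | hx
  · simp [hx]
  · simp [h x hx]

/-- The elementary function `x ↦ k x • e`. -/
noncomputable def elementary (k : C₀(X, ℝ)) (e : E) : C₀(X, E) where
  toFun x := k x • e
  continuous_toFun := by fun_prop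
  zero_at_infty' := by simpa using (zero_at_infty k).smul_const e

@[simp]
theorem elementary_apply (k : C₀(X, ℝ)) (e : E) (x : X) : elementary k e x = k x • e := rfl

theorem norm_elementary_le {k : C₀(X, ℝ)} (hk : ∀ x, k x ∈ Icc (0 : ℝ) 1) (e : E) :
    ‖elementary k e‖ ≤ ‖e‖ :=
  norm_le_of_forall_norm_apply_le (norm_nonneg e) fun x => by
    rw [elementary_apply, norm_smul, Real.norm_of_nonneg (hk x).1]
    exact mul_le_of_le_one_left (norm_nonneg e) (hk x).2

theorem norm_mulScalar_le {u : C₀(X, ℝ)} (hu : ∀ x, u x ∈ Icc (0 : ℝ) 1) {f : C₀(X, E)} {ε : ℝ}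
    (hε : 0 ≤ ε) (hf : ∀ x, u x ≠ 0 → ‖f x‖ ≤ ε) : ‖mulScalar E u f‖ ≤ ε := by
  refine norm_le_of_forall_norm_apply_le hε fun x => ?_
  rcases eq_or_ne (u x) 0 with hx | hx
  · simpa [hx] using hε
  · rw [mulScalar_apply, norm_smul, Real.norm_of_nonneg (hu x).1]
    exact (mul_le_of_le_one_left (norm_nonneg _) (hu x).2).trans (hf x hx)

theorem norm_add_mulScalar_sub_le {u : C₀(X, ℝ)} (hu : ∀ x, u x ∈ Icc (0 : ℝ) 1) {f g : C₀(X, E)}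
    {r : ℝ} (hf : ‖f‖ ≤ r) (hg : ‖g‖ ≤ r) : ‖g + mulScalar E u (f - g)‖ ≤ r := by
  refine norm_le_of_forall_norm_apply_le ((norm_nonneg f).trans hf) fun x => ?_
  have hmem : ∀ {h : C₀(X, E)}, ‖h‖ ≤ r → h x ∈ closedBall (0 : E) r := fun hh =>
    mem_closedBall_zero_iff.2 ((norm_apply_le_norm _ x).trans hh)
  exact mem_closedBall_zero_iff.1
    ((convex_closedBall (0 : E) r).add_smul_sub_mem (hmem hg) (hmem hf) (hu x))

theorem exists_comp_mulScalar_eq_smul {ψ : StrongDual ℝ C₀(X, E)}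
    (hψ : ψ ∈ dualExtremePoints C₀(X, E)) (hψ1 : ‖ψ‖ = 1) {u : C₀(X, ℝ)}
    (hu : ∀ x, u x ∈ Icc (0 : ℝ) 1) : ∃ c : ℝ, ψ ∘L mulScalar E u = c • ψ := by
  refine ⟨_, (mem_extremePoints_closedBall_iff hψ1).1 hψ _
    (norm_add_norm_le_of_forall_apply_add_le fun f g hf hg => ?_)⟩
  calc (ψ ∘L mulScalar E u) f + (ψ - ψ ∘L mulScalar E u) g
      = ψ (g + mulScalar E u (f - g)) := by simp; ring
    _ ≤ ‖g + mulScalar E u (f - g)‖ := apply_le_norm_of_norm_le_one hψ1.le _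
    _ ≤ 1 := norm_add_mulScalar_sub_le hu hf hg

end VanishingAtInfinity

section Concentrated

variable {X E G : Type*} [TopologicalSpace X] [NormedAddCommGroup E] [NormedSpace ℝ E]
  [NormedAddCommGroup G] [NormedSpace ℝ G]

/-- The operator `φ` depends only on the value of the function at `x`. -/
def IsConcentratedAt (φ : C₀(X, E) →L[ℝ] G) (x : X) : Prop :=
  ∀ f : C₀(X, E), f x = 0 → φ f = 0

theorem IsConcentratedAt.congr {φ : C₀(X, E) →L[ℝ] G} {x : X} (hφ : IsConcentratedAt φ x)
    {f g : C₀(X, E)} (h : f x = g x) : φ f = φ g :=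
  sub_eq_zero.1 <| map_sub φ f g ▸ hφ (f - g) (sub_eq_zero.2 h)

theorem exists_eqOn_one_comp_mulScalar_eq_zero {φ : C₀(X, E) →L[ℝ] G}
    (h : ∀ x, ∃ u : C₀(X, ℝ), (∀ z, u z ∈ Icc (0 : ℝ) 1) ∧ (∀ᶠ z in 𝓝 x, u z = 1) ∧
      φ ∘L mulScalar E u = 0) {K : Set X} (hK : IsCompact K) :
    ∃ u : C₀(X, ℝ), (∀ z, u z ∈ Icc (0 : ℝ) 1) ∧ EqOn u 1 K ∧ φ ∘L mulScalar E u = 0 := by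
  refine hK.induction_on (p := fun K => ∃ u : C₀(X, ℝ), (∀ z, u z ∈ Icc (0 : ℝ) 1) ∧ EqOn u 1 K ∧
    φ ∘L mulScalar E u = 0) ?empty ?mono ?union ?nhds
  case empty => exact ⟨0, by simp, eqOn_empty _ _, by rw [mulScalar_zero, φ.comp_zero]⟩
  case mono =>
    rintro s t hst ⟨u, hu, hu1, hφ⟩
    exact ⟨u, hu, hu1.mono hst, hφ⟩
  case union =>
    rintro s t ⟨u, hu, hu1, hφu⟩ ⟨v, hv, hv1, hφv⟩
    refine ⟨u + v - u * v, fun z => ?_, ?_, ?_⟩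
    · obtain ⟨hu0, hu1⟩ := hu z
      obtain ⟨hv0, hv1⟩ := hv z
      constructor <;> simp <;> nlinarith
    · rintro z (hz | hz)
      · simp [hu1 hz]
      · simp [hv1 hz]
    · ext f
      have hadd : mulScalar E (u + v - u * v) f =
          mulScalar E u f + mulScalar E v (f - mulScalar E u f) := by
        ext z
        simp
        module
      calc φ (mulScalar E (u + v - u * v) f)
          = φ (mulScalar E u f) + φ (mulScalar E v (f - mulScalar E u f)) := by rw [hadd, map_add]
        _ = 0 := (congrArg₂ (· + ·) (DFunLike.congr_fun hφu f) (DFunLike.congr_fun hφv _)).trans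
            (add_zero 0)
  case nhds =>
    intro x _
    obtain ⟨u, hu, hu1, hφ⟩ := h x
    exact ⟨_, mem_nhdsWithin_of_mem_nhds hu1, u, hu, fun z hz => hz, hφ⟩

theorem eq_zero_of_forall_comp_mulScalar_eq_zero {φ : C₀(X, E) →L[ℝ] G}
    (h : ∀ x, ∃ u : C₀(X, ℝ), (∀ z, u z ∈ Icc (0 : ℝ) 1) ∧ (∀ᶠ z in 𝓝 x, u z = 1) ∧
      φ ∘L mulScalar E u = 0) : φ = 0 := by
  ext f
  refine φ.isClosed_ker.closure_subset (Metric.mem_closure_iff.2 fun ε hε => ?_)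
  have hf : ∀ᶠ x in cocompact X, ‖f x‖ ≤ ε / 2 :=
    (zero_at_infty f).norm.eventually_le_const (by simpa using half_pos hε)
  obtain ⟨K, hK, hKf⟩ := mem_cocompact.1 hf
  obtain ⟨u, hu, hu1, hφ⟩ := exists_eqOn_one_comp_mulScalar_eq_zero h hK
  refine ⟨mulScalar E u f, DFunLike.congr_fun hφ f, ?_⟩
  rw [dist_eq_norm]
  refine (norm_le_of_forall_norm_apply_le (half_pos hε).le fun x => ?_).trans_lt (half_lt_self hε)
  by_cases hx : x ∈ K
  · simpa [hu1 hx] using (half_pos hε).le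
  · calc ‖f x - u x • f x‖ = (1 - u x) * ‖f x‖ := by
          rw [← Real.norm_of_nonneg (sub_nonneg.2 (hu x).2), ← norm_smul, sub_smul, one_smul]
      _ ≤ ‖f x‖ := mul_le_of_le_one_left (norm_nonneg _) (sub_le_self _ (hu x).1)
      _ ≤ ε / 2 := hKf hx

variable [LocallyCompactSpace X] [T2Space X]

theorem exists_bump {x : X} {U : Set X} (hU : U ∈ 𝓝 x) :
    ∃ u : C₀(X, ℝ), (∀ z, u z ∈ Icc (0 : ℝ) 1) ∧ (∀ᶠ z in 𝓝 x, u z = 1) ∧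
      ∀ z, u z ≠ 0 → z ∈ U := by
  obtain ⟨K, hKx, hKU, hK⟩ := local_compact_nhds (interior_mem_nhds.2 hU)
  obtain ⟨u, hu1, hu0, huc, hu⟩ := exists_continuous_one_zero_of_isCompact hK
    isOpen_interior.isClosed_compl (disjoint_compl_right_iff_subset.2 hKU)
  refine ⟨⟨u, huc.is_zero_at_infty⟩, hu, mem_of_superset hKx fun z hz => hu1 hz, fun z hz => ?_⟩
  exact interior_subset (not_not.1 fun hzU => hz (hu0 hzU))

theorem exists_bump_of_ne {x₁ x₂ : X} (hne : x₁ ≠ x₂) :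
    ∃ u : C₀(X, ℝ), (∀ z, u z ∈ Icc (0 : ℝ) 1) ∧ u x₁ = 1 ∧ u x₂ = 0 := by
  obtain ⟨u, hu, hu1, hu0⟩ := exists_bump (isOpen_compl_singleton.mem_nhds hne)
  exact ⟨u, hu, hu1.self_of_nhds, not_not.1 fun h => hu0 x₂ h rfl⟩

theorem exists_zeroAtInfty_apply_eq (x : X) (e : E) : ∃ f : C₀(X, E), f x = e ∧ ‖f‖ ≤ ‖e‖ := by
  obtain ⟨k, hk, hk1, -⟩ := exists_bump (univ_mem (f := 𝓝 x))
  exact ⟨elementary k e, by simp [hk1.self_of_nhds], norm_elementary_le hk e⟩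

theorem norm_comp_evalCLM (v : E →L[ℝ] G) (x : X) : ‖v ∘L evalCLM E x‖ = ‖v‖ := by
  refine le_antisymm ?_ (v.opNorm_le_bound (norm_nonneg (v ∘L evalCLM E x)) fun e => ?_)
  · exact (v.opNorm_comp_le _).trans
      (mul_le_of_le_one_right (norm_nonneg v) (norm_evalCLM_le_one x))
  · obtain ⟨f, rfl, hf⟩ := exists_zeroAtInfty_apply_eq x e
    exact (v ∘L evalCLM E x).le_opNorm_of_le hf

theorem IsConcentratedAt.exists_eq_comp_evalCLM {φ : C₀(X, E) →L[ℝ] G} {x : X}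
    (hφ : IsConcentratedAt φ x) : ∃ v : E →L[ℝ] G, φ = v ∘L evalCLM E x := by
  choose s hs hsn using exists_zeroAtInfty_apply_eq (E := E) x
  refine ⟨LinearMap.mkContinuous
    { toFun e := φ (s e)
      map_add' a b := by rw [← map_add]; exact hφ.congr (by simp [hs])
      map_smul' c a := by rw [← map_smul]; exact hφ.congr (by simp [hs]) } ‖φ‖
    fun e => φ.le_opNorm_of_le (hsn e), ContinuousLinearMap.ext fun f => ?_⟩
  exact hφ.congr (hs (f x)).symm

theorem isConcentratedAt_of_add_eq_comp_evalCLM {ψ₁ ψ₂ : StrongDual ℝ C₀(X, E)}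
    {w : StrongDual ℝ E} {x : X} (hadd : ψ₁ + ψ₂ = w ∘L evalCLM E x)
    (hnorm : ‖ψ₁‖ + ‖ψ₂‖ ≤ ‖w‖) : IsConcentratedAt ψ₁ x := by
  set N := (evalCLM E x).ker
  set θ : StrongDual ℝ N := ψ₁ ∘L N.subtypeL
  suffices hθ : ‖w‖ + ‖θ‖ ≤ ‖ψ₁‖ + ‖ψ₂‖ by
    have hle : ‖θ‖ ≤ 0 := by linarith
    have hθ0 : θ = 0 := norm_le_zero_iff (a := θ) |>.1 hle
    exact fun f hf => DFunLike.congr_fun hθ0 ⟨f, hf⟩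
  refine norm_add_norm_le_of_forall_apply_add_le fun v ⟨h, hx⟩ hv hh => ?_
  refine le_iff_forall_one_lt_le_mul₀ (by positivity) |>.2 fun r hr => ?_
  -- A bump in direction `v`, so narrow that adding `h` does not increase its norm beyond `r`.
  have hx0 : ‖h x‖ < r - 1 := by rw [show h x = 0 from hx, norm_zero]; linarith
  have hU : {z | ‖h z‖ ≤ r - 1} ∈ 𝓝 x :=
    (map_continuous h).norm.continuousAt.eventually_le_const hx0
  obtain ⟨k, hk, hk1, hk0⟩ := exists_bump hU
  have hkv : ‖elementary k v‖ ≤ 1 := (norm_elementary_le hk v).trans hv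
  have hkvh : ‖elementary k v + h‖ ≤ r := by
    refine norm_le_of_forall_norm_apply_le (by linarith) fun z => ?_
    rcases eq_or_ne (k z) 0 with hz | hz
    · simpa [hz] using ((norm_apply_le_norm h z).trans hh).trans hr.le
    · refine (norm_add_le (elementary k v z) (h z)).trans ?_
      have hhz : ‖h z‖ ≤ r - 1 := hk0 z hz
      linarith [(norm_apply_le_norm _ z).trans hkv]
  have hw : w v = ψ₁ (elementary k v) + ψ₂ (elementary k v) := by
    rw [← add_apply, hadd]
    simp [hk1.self_of_nhds]
  calc w v + θ ⟨h, hx⟩ = ψ₁ (elementary k v + h) + ψ₂ (elementary k v) := by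
        rw [hw, map_add, add_right_comm]; rfl
    _ ≤ ‖ψ₁‖ * r + ‖ψ₂‖ * r := add_le_add
        ((le_abs_self _).trans (ψ₁.le_opNorm_of_le hkvh))
        ((le_abs_self _).trans (ψ₂.le_opNorm_of_le (hkv.trans hr.le)))
    _ = (‖ψ₁‖ + ‖ψ₂‖) * r := by ring

theorem comp_evalCLM_mem_dualExtremePoints [Nontrivial E] {w : StrongDual ℝ E}
    (hw : w ∈ dualExtremePoints E) (x : X) :
    w ∘L evalCLM E x ∈ dualExtremePoints C₀(X, E) := by
  have hw1 := norm_eq_one_of_mem_dualExtremePoints hw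
  refine (mem_extremePoints_closedBall_iff ((norm_comp_evalCLM w x).trans hw1)).2 fun a ha => ?_
  obtain ⟨v, rfl⟩ := (isConcentratedAt_of_add_eq_comp_evalCLM (add_sub_cancel a _)
    (ha.trans_eq hw1.symm)).exists_eq_comp_evalCLM
  rw [← ContinuousLinearMap.sub_comp, norm_comp_evalCLM, norm_comp_evalCLM] at ha
  rw [norm_comp_evalCLM, ← ContinuousLinearMap.smul_comp,
    ← (mem_extremePoints_closedBall_iff hw1).1 hw v ha]

theorem exists_comp_mulScalar_eq_zero {ψ : StrongDual ℝ C₀(X, E)}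
    (hψ : ψ ∈ dualExtremePoints C₀(X, E)) (hψ1 : ‖ψ‖ = 1) {x : X}
    (hx : ¬ IsConcentratedAt ψ x) :
    ∃ u : C₀(X, ℝ), (∀ z, u z ∈ Icc (0 : ℝ) 1) ∧ (∀ᶠ z in 𝓝 x, u z = 1) ∧
      ψ ∘L mulScalar E u = 0 := by
  simp only [IsConcentratedAt, not_forall] at hx
  obtain ⟨g, hgx, hψg⟩ := hx
  have hpos : 0 < |ψ g| := abs_pos.2 hψg
  have hU : {z | ‖g z‖ ≤ |ψ g| / 2} ∈ 𝓝 x :=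
    (map_continuous g).norm.continuousAt.eventually_le_const (by simpa [hgx] using half_pos hpos)
  obtain ⟨u, hu, hu1, huU⟩ := exists_bump hU
  obtain ⟨c, hc⟩ := exists_comp_mulScalar_eq_smul hψ hψ1 hu
  have apply_mul : ∀ f, ψ (mulScalar E u f) = c * ψ f := DFunLike.congr_fun hc
  have hc1 : c ≠ 1 := by
    rintro rfl
    have hle : |ψ g| ≤ |ψ g| / 2 := calc
      |ψ g| = |ψ (mulScalar E u g)| := by rw [apply_mul, one_mul]
      _ ≤ ‖mulScalar E u g‖ := by simpa [hψ1] using ψ.le_opNorm (mulScalar E u g)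
      _ ≤ |ψ g| / 2 := norm_mulScalar_le hu (half_pos hpos).le huU
    linarith
  obtain ⟨v, hv, hv1, hvu⟩ := exists_bump hu1
  refine ⟨v, hv, hv1, ContinuousLinearMap.ext fun f => ?_⟩
  have hfix := apply_mul (mulScalar E v f)
  rw [mulScalar_mulScalar_of_forall_eq_one hvu] at hfix
  exact not_not.1 fun h0 => hc1 ((right_eq_mul₀ h0).1 hfix)

theorem exists_isConcentratedAt_of_mem_dualExtremePoints {ψ : StrongDual ℝ C₀(X, E)}
    (hψ : ψ ∈ dualExtremePoints C₀(X, E)) (hψ1 : ‖ψ‖ = 1) : ∃ x, IsConcentratedAt ψ x := by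
  by_contra! hx
  have hψ0 : ψ = 0 := eq_zero_of_forall_comp_mulScalar_eq_zero fun x =>
    exists_comp_mulScalar_eq_zero hψ hψ1 (hx x)
  exact one_ne_zero (hψ1.symm.trans (ψ.opNorm_zero_iff.2 hψ0))

end Concentrated

section Isometries

variable {X Y E F : Type*} [TopologicalSpace X] [LocallyCompactSpace X] [T2Space X]
  [TopologicalSpace Y] [LocallyCompactSpace Y] [T2Space Y]
  [NormedAddCommGroup E] [NormedSpace ℝ E] [NormedAddCommGroup F] [NormedSpace ℝ F]

theorem exists_isConcentratedAt_comp [Nontrivial F] (T : C₀(X, E) ≃ₗᵢ[ℝ] C₀(Y, F))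
    {w : StrongDual ℝ F} (hw : w ∈ dualExtremePoints F) (y : Y) :
    ∃ x, IsConcentratedAt ((w ∘L evalCLM F y) ∘L (T : C₀(X, E) →L[ℝ] C₀(Y, F))) x :=
  exists_isConcentratedAt_of_mem_dualExtremePoints
    (comp_mem_dualExtremePoints T (comp_evalCLM_mem_dualExtremePoints hw y))
    (((w ∘L evalCLM F y).opNorm_comp_linearIsometryEquiv T).trans
      ((norm_comp_evalCLM w y).trans (norm_eq_one_of_mem_dualExtremePoints hw)))

theorem ballIndependent_of_isConcentratedAt_of_ne (T : C₀(X, E) ≃ₗᵢ[ℝ] C₀(Y, F)) {y : Y}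
    {w₁ w₂ : StrongDual ℝ F} {x₁ x₂ : X} (hne : x₁ ≠ x₂)
    (h₁ : IsConcentratedAt ((w₁ ∘L evalCLM F y) ∘L (T : C₀(X, E) →L[ℝ] C₀(Y, F))) x₁)
    (h₂ : IsConcentratedAt ((w₂ ∘L evalCLM F y) ∘L (T : C₀(X, E) →L[ℝ] C₀(Y, F))) x₂) :
    BallIndependent w₁ w₂ := by
  intro z₁ z₂ hz₁ hz₂
  obtain ⟨g₁, rfl, hg₁⟩ := exists_zeroAtInfty_apply_eq y z₁
  obtain ⟨g₂, rfl, hg₂⟩ := exists_zeroAtInfty_apply_eq y z₂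
  obtain ⟨u, hu, hux₁, hux₂⟩ := exists_bump_of_ne hne
  let f := T.symm g₂ + mulScalar E u (T.symm g₁ - T.symm g₂)
  have hf : ‖f‖ ≤ 1 := norm_add_mulScalar_sub_le hu
    ((T.symm.norm_map g₁).trans_le (hg₁.trans hz₁)) ((T.symm.norm_map g₂).trans_le (hg₂.trans hz₂))
  have hf₁ : f x₁ = T.symm g₁ x₁ := by simp [f, hux₁]
  have hf₂ : f x₂ = T.symm g₂ x₂ := by simp [f, hux₂]
  refine ⟨T f y, (norm_apply_le_norm (T f) y).trans ((T.norm_map f).trans_le hf), ?_, ?_⟩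
  · simpa using h₁.congr hf₁
  · simpa using h₂.congr hf₂

theorem HasLinkedDual.exists_isConcentratedAt [Nontrivial F] (hF : HasLinkedDual F)
    (T : C₀(X, E) ≃ₗᵢ[ℝ] C₀(Y, F)) (y : Y) :
    ∃ x, IsConcentratedAt (evalCLM F y ∘L (T : C₀(X, E) →L[ℝ] C₀(Y, F))) x := by
  obtain ⟨w₀, hw₀, hsep⟩ := hF
  obtain ⟨x, hx⟩ := exists_isConcentratedAt_comp T hw₀ y
  have concentrated : ∀ w, Relation.ReflTransGen Linked w₀ w →
      IsConcentratedAt ((w ∘L evalCLM F y) ∘L (T : C₀(X, E) →L[ℝ] C₀(Y, F))) x := by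
    intro w hw
    induction hw with
    | refl => exact hx
    | tail _ hlink ih =>
      obtain ⟨x', hx'⟩ := exists_isConcentratedAt_comp T hlink.1 y
      obtain rfl : x = x' := not_not.1 fun hne =>
        hlink.2 (ballIndependent_of_isConcentratedAt_of_ne T hne ih hx')
      exact hx'
  refine ⟨x, fun f hf => not_not.1 fun hne => ?_⟩
  obtain ⟨w, hw, hwne⟩ := hsep _ hne
  exact hwne (concentrated w hw f hf)

end Isometries

section WeightedComposition

variable {X Y E F : Type*} [TopologicalSpace X] [TopologicalSpace Y] [NormedAddCommGroup E]
  [NormedSpace ℝ E] [NormedAddCommGroup F] [NormedSpace ℝ F]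

/-- The map `T` is the weighted composition operator with symbol `Φ` and operator-valued
weight `V`. -/
def IsWeightedComposition (T : C₀(X, E) → C₀(Y, F)) (Φ : Y → X) (V : Y → E →L[ℝ] F) : Prop :=
  ∀ (f : C₀(X, E)) (y : Y), T f y = V y (f (Φ y))

variable [LocallyCompactSpace X] [T2Space X]

theorem IsWeightedComposition.continuous {T : C₀(X, E) → C₀(Y, F)} {Φ : Y → X}
    {V : Y → E →L[ℝ] F} (hT : IsWeightedComposition T Φ V) (hne : ∀ y, ∃ f, T f y ≠ 0) :
    Continuous Φ := by
  refine continuous_iff_continuousAt.2 fun y => tendsto_def.2 fun U hU => ?_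
  obtain ⟨f, hf⟩ := hne y
  obtain ⟨u, -, hu1, huU⟩ := exists_bump hU
  have hy : T (mulScalar E u f) y ≠ 0 := by
    rwa [hT, mulScalar_apply, hu1.self_of_nhds, one_smul, ← hT]
  filter_upwards [(map_continuous (T (mulScalar E u f))).continuousAt.eventually_ne hy] with z hz
  refine huU _ fun h0 => hz ?_
  rw [hT, mulScalar_apply, h0, zero_smul, map_zero]

variable {T : C₀(X, E) → C₀(Y, F)} {S : C₀(Y, F) → C₀(X, E)} {Φ : Y → X} {Ψ : X → Y}
  {V : Y → E →L[ℝ] F} {W : X → F →L[ℝ] E}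

theorem IsWeightedComposition.symbol_leftInverse [Nontrivial E] (hT : IsWeightedComposition T Φ V)
    (hS : IsWeightedComposition S Ψ W) (hST : Function.LeftInverse S T) :
    Function.LeftInverse Φ Ψ := by
  intro x
  by_contra hne
  obtain ⟨e, he⟩ := exists_ne (0 : E)
  obtain ⟨k, -, hk1, hk0⟩ := exists_bump_of_ne (Ne.symm hne)
  have hx : S (T (elementary k e)) x = 0 := by rw [hS, hT, elementary_apply, hk0]; simp
  rw [hST, elementary_apply, hk1, one_smul] at hx
  exact he hx

theorem IsWeightedComposition.weight_leftInverse (hT : IsWeightedComposition T Φ V)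
    (hS : IsWeightedComposition S Ψ W) (hST : Function.LeftInverse S T) {x : X}
    (hx : Φ (Ψ x) = x) : Function.LeftInverse (W x) (V (Ψ x)) := by
  intro e
  obtain ⟨f, rfl, -⟩ := exists_zeroAtInfty_apply_eq x e
  calc W x (V (Ψ x) (f x)) = S (T f) x := by rw [hS, hT, hx]
    _ = f x := by rw [hST]

variable [LocallyCompactSpace Y] [T2Space Y]

theorem HasLinkedDual.exists_isWeightedComposition [Nontrivial F] (hF : HasLinkedDual F)
    (T : C₀(X, E) ≃ₗᵢ[ℝ] C₀(Y, F)) :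
    ∃ (Φ : Y → X) (V : Y → E →L[ℝ] F),
      Continuous Φ ∧ (∀ y, ‖V y‖ ≤ 1) ∧ IsWeightedComposition T Φ V := by
  choose Φ hΦ using hF.exists_isConcentratedAt T
  choose V hV using fun y => (hΦ y).exists_eq_comp_evalCLM
  have hT : IsWeightedComposition T Φ V := fun f y => DFunLike.congr_fun (hV y) f
  refine ⟨Φ, V, hT.continuous fun y => ?_, fun y => ?_, hT⟩
  · obtain ⟨b, hb⟩ := exists_ne (0 : F)
    obtain ⟨g, hg, -⟩ := exists_zeroAtInfty_apply_eq y b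
    exact ⟨T.symm g, by rwa [T.apply_symm_apply, hg]⟩
  · calc ‖V y‖ = ‖evalCLM F y ∘L (T : C₀(X, E) →L[ℝ] C₀(Y, F))‖ := by
          rw [hV y, norm_comp_evalCLM]
      _ = ‖evalCLM F y‖ := (evalCLM F y).opNorm_comp_linearIsometryEquiv T
      _ ≤ 1 := norm_evalCLM_le_one y

end WeightedComposition

theorem isometry_of_leftInverse_of_norm_le_one {E F : Type*} [NormedAddCommGroup E]
    [NormedSpace ℝ E] [NormedAddCommGroup F] [NormedSpace ℝ F] {V : E →L[ℝ] F} {W : F →L[ℝ] E}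
    (hV : ‖V‖ ≤ 1) (hW : ‖W‖ ≤ 1) (hWV : Function.LeftInverse W V) : Isometry V := by
  refine AddMonoidHomClass.isometry_of_norm V fun e => le_antisymm ?_ ?_
  · simpa using V.le_of_opNorm_le hV e
  · simpa [hWV e] using W.le_of_opNorm_le hW (V e)

theorem theorem3p1_general {X Y E F : Type*}
    [TopologicalSpace X] [LocallyCompactSpace X] [T2Space X]
    [TopologicalSpace Y] [LocallyCompactSpace Y] [T2Space Y]
    [NormedAddCommGroup E] [NormedSpace ℝ E] [NormedAddCommGroup F] [NormedSpace ℝ F]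
    [Nontrivial F] (T : C₀(X, E) →ₗᵢ[ℝ] C₀(Y, F)) (hT : Function.Surjective T)
    (hF : HasLinkedDual F) :
    ∃ (Φ : Y → X) (V : Y → E →L[ℝ] F),
      Continuous Φ ∧ (∀ y, ‖V y‖ ≤ 1) ∧ IsWeightedComposition T Φ V ∧
      (Nontrivial E → HasLinkedDual E →
        IsHomeomorph Φ ∧ ∀ y, Isometry (V y) ∧ Function.Surjective (V y)) := by
  let e := LinearIsometryEquiv.ofSurjective T hT
  obtain ⟨Φ, V, hΦ, hV, hTΦ⟩ := hF.exists_isWeightedComposition e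
  refine ⟨Φ, V, hΦ, hV, hTΦ, fun _ hE => ?_⟩
  obtain ⟨Ψ, W, hΨ, hW, hTΨ⟩ := hE.exists_isWeightedComposition e.symm
  have hΦΨ : Function.LeftInverse Φ Ψ := hTΦ.symbol_leftInverse hTΨ e.symm_apply_apply
  have hΨΦ : Function.LeftInverse Ψ Φ := hTΨ.symbol_leftInverse hTΦ e.apply_symm_apply
  refine ⟨(Homeomorph.mk ⟨Φ, Ψ, hΨΦ, hΦΨ⟩ hΦ hΨ).isHomeomorph, fun y => ?_⟩
  have hWV : Function.LeftInverse (W (Φ y)) (V y) := by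
    simpa only [hΨΦ y] using hTΦ.weight_leftInverse hTΨ e.symm_apply_apply (hΦΨ (Φ y))
  have hVW : Function.LeftInverse (V y) (W (Φ y)) :=
    hTΨ.weight_leftInverse hTΦ e.apply_symm_apply (hΨΦ y)
  exact ⟨isometry_of_leftInverse_of_norm_le_one (hV y) (hW _) hWV, hVW.surjective⟩

theorem theorem3p1 {𝕜₁ 𝕜₂ X Y E F : Type*} [RCLike 𝕜₁] [RCLike 𝕜₂]
    [TopologicalSpace X] [LocallyCompactSpace X] [T2Space X]
    [TopologicalSpace Y] [LocallyCompactSpace Y] [T2Space Y]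
    [NormedAddCommGroup E] [NormedSpace 𝕜₁ E] [NormedSpace ℝ E] [IsScalarTower ℝ 𝕜₁ E]
    [NormedAddCommGroup F] [NormedSpace 𝕜₂ F] [NormedSpace ℝ F] [IsScalarTower ℝ 𝕜₂ F]
    [Nontrivial F]
    (T : C₀(X, E) →ₗᵢ[ℝ] C₀(Y, F)) (hT : Function.Surjective T)
    (hF : HasStarPoint F ∨ HasDualStarPoint 𝕜₂ F ∨ PropertyD F) :
    ∃ (Φ : Y → X) (V : Y → E →L[ℝ] F),
      Continuous Φ ∧
      (∀ y, ‖V y‖ ≤ 1) ∧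
      (∀ (f : C₀(X, E)) (y : Y), T f y = V y (f (Φ y))) ∧
      (Nontrivial E →
        ((HasStarPoint F ∧ HasStarPoint E) ∨
          (HasDualStarPoint 𝕜₂ F ∧ HasDualStarPoint 𝕜₁ E) ∨
          (PropertyD F ∧ PropertyD E)) →
        IsHomeomorph Φ ∧ ∀ y, Isometry (V y) ∧ Function.Surjective (V y)) := by
  obtain ⟨Φ, V, hΦ, hV, hTΦ, hiso⟩ :=
    theorem3p1_general T hT (hasLinkedDual_of_conditions hF)
  exact ⟨Φ, V, hΦ, hV, hTΦ, fun hE hEF =>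
    hiso hE (hasLinkedDual_of_conditions (hEF.imp And.right (Or.imp And.right And.right)))⟩
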